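/- Let $\lambda=(\lambda_1\ge\lambda_2\ge\cdots)$ and $\mu=(\mu_1\ge\mu_2\ge\cdots)$ be integer partitions of the same size such that $\lambda$ dominates $\mu$, i.e. $\sum_{i=1}^t\lambda_i\ge\sum_{i=1}^t\mu_i$ for all $t\ge 1$. Let $\ell(\mu)$ denote the number of nonzero parts of $\mu$. For an integer $r\ge 0$ define the Kostka cone $$\mathsf{Kostka}_r=\Big\{(a,b)\in\mathbb R^{r}\times\mathbb R^r:\ a_1\ge\cdots\ge a_r\ge 0,\ b_1\ge\cdots\ge b_r\ge 0,\ \sum_{i=1}^t a_i\ge\sum_{i=1}^t b_i\ (1\le t\le r-1),\ \sum_{i=1}^r a_i=\sum_{i=1}^r b_i\Big\}.$$ A Hilbert basis of $\mathsf{Kostka}_r$ is a finite set of integral points of $\mathsf{Kostka}_r$ such that every integral point of $\mathsf{Kostka}_r$ is a nonnegative integral combination of its elements. If $\ell(\mu)<\lambda_1$, then for every $r\ge\ell(\mu)$ the cone $\mathsf{Kostka}_r$ has a unique inclusion-minimal Hilbert basis ("the Hilbert basis of $\mathsf{Kostka}_r^{\mathbb Z}$"), and $(\lambda,\mu)$,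 viewed as a point of $\mathbb R^{r}\times\mathbb R^r$ by padding with zeros, does not belong to it. -/

import Mathlib

namespace KostkaSemigroup

/-- `part p i` is the `(i + 1)`-st largest part of the partition `p`; it is `0` when `p` has at
most `i` parts. So `part p 0` is the first (largest) part. -/
def part {n : ℕ} (p : n.Partition) (i : ℕ) : ℕ :=
  (p.parts.sort (· ≥ ·)).getD i 0

/-- The length of a partition: the number of its nonzero parts. (All entries of `Nat.Partition.parts`
are positive.) -/
def length {n : ℕ} (p : n.Partition) : ℕ :=
  p.parts.card

/-- Dominance order: `Dominates p q` says that the sum of the `t` largest parts of `p` is at least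
the sum of the `t` largest parts of `q`, for every `t`. -/
def Dominates {n : ℕ} (p q : n.Partition) : Prop :=
  ∀ t : ℕ, ∑ i ∈ Finset.range t, part q i ≤ ∑ i ∈ Finset.range t, part p i

/-- The integral points of a subset of `ℝ ^ ι`. -/
def integralPoints {ι : Type*} (C : Set (ι → ℝ)) : Set (ι → ℝ) :=
  {x | x ∈ C ∧ ∀ i, ∃ z : ℤ, x i = (z : ℝ)}

/-- `H` is a Hilbert basis of the cone `C` (not necessarily a minimal one): a finite set of integral
points of `C` such that every integral point of `C` is a combination of elements of `H` with
coefficients in `ℕ`. -/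
structure IsHilbertBasis {ι : Type*} (C H : Set (ι → ℝ)) : Prop where
  finite : H.Finite
  subset : H ⊆ integralPoints C
  generates : ∀ x ∈ integralPoints C, x ∈ Submodule.span ℕ H

/-- `H` is *the* Hilbert basis of the cone `C`: it is the unique Hilbert basis of `C` that is
minimal with respect to inclusion. -/
def IsTheHilbertBasis {ι : Type*} (C H : Set (ι → ℝ)) : Prop :=
  Minimal (IsHilbertBasis C) H ∧ ∀ H', Minimal (IsHilbertBasis C) H' → H' = H

/-- The Kostka cone in `ℝ ^ (2 r)`, whose points are written as pairs `(a, b)` of vectors in `ℝ ^ r`: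
the left summand of the index type carries `a`, the right one carries `b`. -/
def kostkaCone (r : ℕ) : Set (Fin r ⊕ Fin r → ℝ) :=
  {x | ∃ a b : Fin r → ℝ, x = Sum.elim a b ∧
    Antitone a ∧ (∀ i, 0 ≤ a i) ∧
    Antitone b ∧ (∀ i, 0 ≤ b i) ∧
    (∀ t : Fin r, ∑ i ∈ Finset.Iic t, b i ≤ ∑ i ∈ Finset.Iic t, a i) ∧
    ∑ i, a i = ∑ i, b i}

/-- A pair of partitions as a point of `ℝ ^ (2 r)`: the first `r` parts of each, padded by zeros. -/
def pairVector {n : ℕ} (r : ℕ) (p q : n.Partition) : Fin r ⊕ Fin r → ℝ :=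
  Sum.elim (fun i => (part p i : ℝ)) (fun i => (part q i : ℝ))

end KostkaSemigroup

/-! It suffices to split `(λ, μ)` into two nonzero dominant pairs: the irreducible integral points
form the only minimal Hilbert basis. The splitting is done with `r = ℓ(μ)` and then padded by zeros.

Regard a partition as a sum of columns, and set aside from `μ` its full column, of height `r`. At
each stage the remaining columns of `λ` are dominated by the remaining columns of `μ` plus one
leftover column of height `z`. If `λ` still has a column of height exactly `z`, cancelling it
against the leftover splits the pair (`splits_of_left_lt`). Otherwise the dominance gap has a convex
kink at `z`, so it lies above a trapezoid with corners at `z`, `y` and `x`, `z + y - x`. This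
trapezoid is the cost of removing a column `x` from `λ` and a column `y` from `μ` while the leftover
becomes `z + y - x`, still in `[1, r]` (`Stage.Valid.exists_next`).

Since `λ₁ > r`, this yields `r + 1` stages before `λ` is exhausted. Two of them have the same
leftover height, and what was removed between them is a dominant pair with dominant complement
(`splits_of_height_eq`). -/

namespace KostkaSemigroup

/-! ### Columns -/

/-- The column `(1, …, 1, 0, 0, …)` with `x` ones. -/
def column (x : ℕ) (i : ℕ) : ℤ := if i < x then 1 else 0

lemma sum_column (x k : ℕ) : ∑ i ∈ Finset.range k, column x i = min k x := by
  induction k with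
  | zero => simp
  | succ k ih =>
    rw [Finset.sum_range_succ, ih, column]
    split_ifs <;> push_cast <;> omega

lemma antitone_column (x : ℕ) : Antitone (column x) := by
  refine antitone_nat_of_succ_le fun i => ?_
  unfold column
  split_ifs <;> omega

/-- A strict drop at `x` means that `a` contains a column of height `x`; the empty column `x = 0`
needs no drop. -/
lemma antitone_sub_column {a : ℕ → ℤ} (ha : Antitone a) {x : ℕ}
    (hx : 0 < x → a x < a (x - 1)) : Antitone (a - column x) := by
  refine antitone_nat_of_succ_le fun i => ?_
  have h := ha (Nat.le_add_right i 1)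
  simp only [Pi.sub_apply, column]
  by_cases hi : i + 1 = x
  · subst hi
    have := hx (Nat.succ_pos i)
    simp only [Nat.add_sub_cancel] at this
    simp
    omega
  · split_ifs <;> omega

/-! ### Trapezoids under a nonnegative sequence -/

/-- A sequence with slopes `s`, read off from its differences, is bounded below by a trapezoid
starting at a local "kink" `z` and extending to the right. -/
lemma exists_trapezoid_right {r z : ℕ} {f s : ℕ → ℤ} (hf : ∀ k, f (k + 1) = f k + s k)
    (hpos : ∀ k, 0 ≤ f k) (hend : ∀ k, r ≤ k → f k = 0) (hz : 1 ≤ s z) :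
    ∃ x y : ℕ, z < x ∧ x < y ∧ y ≤ r ∧ s x < s (x - 1) ∧ s (y - 1) < s y ∧
      ∀ k, (min k x + min k (z + y - x) : ℤ) - min k z - min k y ≤ f k := by
  have hs0 : ∀ k, r ≤ k → s k = 0 := fun k hk => by
    have := hf k
    rw [hend k hk, hend (k + 1) (by omega)] at this
    omega
  have hzr : z < r := by
    by_contra h
    have := hs0 z (by omega)
    omega
  -- `f` is positive just after `z` and vanishes from `r` on, so it must descend; `w` is the first
  -- descent.
  have hw : ∃ w, z < w ∧ s w ≤ -1 := by
    by_contra! h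
    have : ∀ k, z + 1 ≤ k → 1 ≤ f k := by
      intro k hk
      induction k, hk using Nat.le_induction with
      | base => have := hf z; have := hpos z; omega
      | succ k hk ih => have := hf k; have := h k (by omega); omega
    have h1 := this r hzr
    rw [hend r le_rfl] at h1
    omega
  classical
  obtain ⟨hw1, hw2⟩ := Nat.find_spec hw
  have hwm : ∀ k, z < k → k < Nat.find hw → 0 ≤ s k := fun k hk hk' => by
    have := Nat.find_min hw hk'
    by_contra hh
    exact this ⟨hk, by omega⟩
  generalize Nat.find hw = w at *
  -- The slopes vanish eventually, so they cannot stay negative; `y` is their first rise after `w`.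
  have hy : ∃ y, w < y ∧ s (y - 1) < s y := by
    by_contra! h
    have : ∀ k, w ≤ k → s k ≤ -1 := by
      intro k hk
      induction k, hk using Nat.le_induction with
      | base => exact hw2
      | succ k hk ih => have := h (k + 1) (by omega); simp at this; omega
    have h1 := this (max w r) (le_max_left _ _)
    rw [hs0 _ (le_max_right _ _)] at h1
    omega
  obtain ⟨hy1, hy2⟩ := Nat.find_spec hy
  have hym : ∀ k, w < k → k < Nat.find hy → s k ≤ s (k - 1) := fun k hk hk' => by
    have := Nat.find_min hy hk'
    by_contra hh
    exact this ⟨hk, by omega⟩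
  generalize Nat.find hy = y at *
  have hneg : ∀ k, w ≤ k → k < y → s k ≤ -1 := by
    intro k hk
    induction k, hk using Nat.le_induction with
    | base => exact fun _ => hw2
    | succ k hk ih =>
      intro hk'
      have := hym (k + 1) (by omega) hk'
      have := ih (by omega)
      simp at *
      omega
  -- `x` ends the initial climb: `f` climbs on `[z, x]`, does not fall on `[x, w]`, and falls on
  -- `[w, y]`.
  have hx : ∃ x, z < x ∧ s x ≤ 0 := ⟨w, hw1, by omega⟩
  obtain ⟨hx1, hx2⟩ := Nat.find_spec hx
  have hxw : Nat.find hx ≤ w := Nat.find_min' hx ⟨hw1, by omega⟩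
  have hxm : ∀ k, z ≤ k → k < Nat.find hx → 1 ≤ s k := fun k hk hk' => by
    have := Nat.find_min hx hk'
    by_contra hh
    rcases hk.eq_or_lt with rfl | hlt
    · omega
    · exact this ⟨hlt, by omega⟩
  generalize Nat.find hx = x at *
  have h1 : ∀ k, z ≤ k → k ≤ x → (k : ℤ) - z ≤ f k := by
    intro k hk
    induction k, hk using Nat.le_induction with
    | base => have := hpos z; intro; omega
    | succ k hk ih =>
      intro hk'
      have := ih (by omega)
      have := hxm k hk (by omega)
      have := hf k
      push_cast
      omega
  have h2 : ∀ k, x ≤ k → k ≤ w → (x : ℤ) - z ≤ f k := by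
    intro k hk
    induction k, hk using Nat.le_induction with
    | base => exact fun _ => h1 x hx1.le le_rfl
    | succ k hk ih =>
      intro hk'
      have := ih (by omega)
      have := hwm k (by omega) (by omega)
      have := hf k
      omega
  have h3 : ∀ j k, k + j = y → w ≤ k → (j : ℤ) ≤ f k := by
    intro j
    induction j with
    | zero => intro k _ _; exact hpos k
    | succ j ih =>
      intro k hk hk'
      have := ih (k + 1) (by omega) (by omega)
      have := hneg k hk' (by omega)
      have := hf k
      push_cast
      omega
  refine ⟨x, y, hx1, by omega, ?_, ?_, hy2, fun k => ?_⟩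
  · by_contra h
    have := hneg (y - 1) (by omega) (by omega)
    have := hs0 (y - 1) (by omega)
    omega
  · have := hxm (x - 1) (by omega) (by omega)
    omega
  -- The trapezoid is bounded by each of `k - z`, `x - z`, `y - k` on the respective interval, and
  -- is `0` outside `[z, y]`.
  · have h0 := hpos k
    rcases le_or_gt k x with hk | hk
    · rcases le_or_gt z k with hk' | hk'
      · have := h1 k hk' hk
        omega
      · omega
    rcases le_or_gt k w with hk' | hk'
    · have := h2 k hk.le hk'
      omega
    rcases le_or_gt k y with hk'' | hk''
    · have := h3 (y - k) k (by omega) hk'.le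
      omega
    · omega

/-- The mirror image of `exists_trapezoid_right`. -/
lemma exists_trapezoid_left {z : ℕ} {f s : ℕ → ℤ} (hf : ∀ k, f (k + 1) = f k + s k)
    (hpos : ∀ k, 0 ≤ f k) (hzero : f 0 = 0) (hz0 : 0 < z) (hz : s (z - 1) ≤ -1) :
    ∃ x y : ℕ, y < x ∧ x < z ∧ s x < s (x - 1) ∧ (0 < y → s (y - 1) < s y) ∧
      ∀ k, (min k x + min k (z + y - x) : ℤ) - min k z - min k y ≤ f k := by
  -- Reflect `k ↦ z - k`, extending by zero slopes.
  let g : ℕ → ℤ := fun k => f (z - k)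
  let t : ℕ → ℤ := fun k => if k < z then -s (z - 1 - k) else 0
  have hg : ∀ k, g (k + 1) = g k + t k := by
    intro k
    simp only [g, t]
    split_ifs with h
    · have := hf (z - 1 - k)
      rw [show z - 1 - k + 1 = z - k by omega] at this
      rw [show z - (k + 1) = z - 1 - k by omega]
      omega
    · rw [show z - (k + 1) = 0 by omega, show z - k = 0 by omega]
      simp
  obtain ⟨x, y, hx0, hxy, hyr, hx, hy, hT⟩ := exists_trapezoid_right (r := z) (z := 0) hg
    (fun k => hpos _) (fun k hk => by simp only [g]; rw [Nat.sub_eq_zero_of_le hk, hzero])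
    (by simp only [t]; rw [if_pos hz0]; simp; omega)
  refine ⟨z - x, z - y, by omega, by omega, ?_, fun h => ?_, fun k => ?_⟩
  · simp only [t] at hx
    rw [if_pos (by omega), if_pos (by omega), show z - 1 - (x - 1) = z - x by omega,
      show z - 1 - x = z - x - 1 by omega] at hx
    omega
  · simp only [t] at hy
    rw [if_pos (by omega), if_pos (by omega), show z - 1 - (y - 1) = z - y by omega,
      show z - 1 - y = z - y - 1 by omega] at hy
    omega
  · have h0 := hpos k
    rcases le_or_gt k z with hk | hk
    · have := hT (z - k)
      simp only [g] at this
      rw [show z - (z - k) = k by omega] at this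
      omega
    · omega

/-! ### Dominant pairs -/

/-- The partial sum of the first `k` entries of the difference of two sequences. -/
def excess (a b : ℕ → ℤ) (k : ℕ) : ℤ := ∑ i ∈ Finset.range k, (a i - b i)

lemma excess_sub (a b a' b' : ℕ → ℤ) (k : ℕ) :
    excess (a - a') (b - b') k = excess a b k - excess a' b' k := by
  simp only [excess, Pi.sub_apply, ← Finset.sum_sub_distrib]
  exact Finset.sum_congr rfl fun _ _ => by ring

@[simp] lemma excess_zero (a b : ℕ → ℤ) : excess a b 0 = 0 := by simp [excess]

lemma excess_succ (a b : ℕ → ℤ) (k : ℕ) :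
    excess a b (k + 1) = excess a b k + (a k - b k) := by
  simp only [excess, Finset.sum_range_succ]

/-- `a` and `b` are partitions of the same size with at most `r` parts, and `a` dominates `b`. -/
structure DominantPair (r : ℕ) (a b : ℕ → ℤ) : Prop where
  antitone_left : Antitone a
  antitone_right : Antitone b
  left_eq_zero : ∀ k, r ≤ k → a k = 0
  right_eq_zero : ∀ k, r ≤ k → b k = 0
  excess_nonneg : ∀ k, 0 ≤ excess a b k
  excess_eq_zero : excess a b r = 0

namespace DominantPair

variable {r : ℕ} {a b a' b' : ℕ → ℤ}

lemma excess_eq_zero_of_le (h : DominantPair r a b) {k : ℕ} (hk : r ≤ k) : excess a b k = 0 := by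
  induction k, hk using Nat.le_induction with
  | base => exact h.excess_eq_zero
  | succ k hk ih => rw [excess_succ, ih, h.left_eq_zero k hk, h.right_eq_zero k hk]; simp

lemma left_nonneg (h : DominantPair r a b) (k : ℕ) : 0 ≤ a k := by
  rw [← h.left_eq_zero (max r k) (le_max_left _ _)]
  exact h.antitone_left (le_max_right _ _)

lemma right_nonneg (h : DominantPair r a b) (k : ℕ) : 0 ≤ b k := by
  rw [← h.right_eq_zero (max r k) (le_max_left _ _)]
  exact h.antitone_right (le_max_right _ _)

end DominantPair

/-- The pair `(a, b)` is a sum of two dominant pairs with nonzero first partition. -/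
def Splits (r : ℕ) (a b : ℕ → ℤ) : Prop :=
  ∃ a' b', DominantPair r a' b' ∧ DominantPair r (a - a') (b - b') ∧ 0 < a' 0 ∧ 0 < (a - a') 0

/-! ### Stages and column exchanges -/

/-- A stage in the process of removing columns from a dominant pair: the columns of `left` have not
been matched yet, and they are dominated by `right` together with a leftover column of height
`height`. -/
structure Stage where
  left : ℕ → ℤ
  right : ℕ → ℤ
  height : ℕ

namespace Stage

/-- The dominance excess of a stage. -/
def gap (s : Stage) : ℕ → ℤ := excess s.left (s.right + column s.height)

/-- The validity of a stage. -/
structure Valid (r : ℕ) (s : Stage) : Prop where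
  antitone_right : Antitone s.right
  pair : DominantPair r s.left (s.right + column s.height)
  height_pos : 0 < s.height
  height_le : s.height ≤ r

lemma Valid.right_eq_zero {r : ℕ} {s : Stage} (hs : s.Valid r) {k : ℕ} (hk : r ≤ k) :
    s.right k = 0 := by
  have h := hs.pair.right_eq_zero k hk
  have := hs.height_le
  simpa [column, show ¬ k < s.height by omega] using h

/-- The stage `t` arises from `s` by matching further columns. -/
structure Le (s t : Stage) : Prop where
  antitone_left : Antitone (s.left - t.left)
  antitone_right : Antitone (s.right - t.right)
  gap_le : ∀ k, t.gap k ≤ s.gap k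

lemma Le.refl (s : Stage) : s.Le s where
  antitone_left := by rw [sub_self]; exact antitone_const
  antitone_right := by rw [sub_self]; exact antitone_const
  gap_le _ := le_rfl

lemma Le.trans {s t u : Stage} (h : s.Le t) (h' : t.Le u) : s.Le u where
  antitone_left := sub_add_sub_cancel s.left t.left u.left ▸ h.antitone_left.add h'.antitone_left
  antitone_right :=
    sub_add_sub_cancel s.right t.right u.right ▸ h.antitone_right.add h'.antitone_right
  gap_le k := (h'.gap_le k).trans (h.gap_le k)

lemma gap_succ (s : Stage) (k : ℕ) :
    s.gap (k + 1) = s.gap k + (s.left k - (s.right + column s.height) k) :=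
  excess_succ _ _ _

/-- A stage obtained from a valid one by removing a column of height `x` on the left and one of
height `y` on the right. -/
lemma Valid.exchange {r : ℕ} {s : Stage} (hs : s.Valid r) {x y : ℕ} (hyr : y ≤ r)
    (hxy : s.height < x ∧ x < y ∨ y < x ∧ x < s.height)
    (hx : s.left x < s.left (x - 1)) (hy : 0 < y → s.right y < s.right (y - 1))
    (hgap : ∀ k, (min k x + min k (s.height + y - x) : ℤ) - min k s.height - min k y ≤ s.gap k) :
    ∃ t : Stage, t.Valid r ∧ s.Le t ∧ t.left 0 + 1 = s.left 0 := by
  have hzr := hs.height_le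
  have hg : ∀ k, excess (s.left - column x) (s.right - column y + column (s.height + y - x)) k
      = s.gap k -
        ((min k x + min k (s.height + y - x) : ℤ) - min k s.height - min k y) := by
    intro k
    simp only [gap, excess, Pi.sub_apply, Pi.add_apply, Finset.sum_sub_distrib,
      Finset.sum_add_distrib, sum_column]
    omega
  have hright : Antitone (s.right - column y) := antitone_sub_column hs.antitone_right hy
  have hgr : s.gap r = 0 := hs.pair.excess_eq_zero
  refine ⟨⟨s.left - column x, s.right - column y, s.height + y - x⟩,
    ⟨hright, ⟨?_, ?_, ?_, ?_, ?_, ?_⟩, ?_, ?_⟩, ⟨?_, ?_, ?_⟩, ?_⟩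
  · exact antitone_sub_column hs.pair.antitone_left fun _ => hx
  · exact hright.add (antitone_column _)
  · intro k hk
    have := hs.pair.left_eq_zero k hk
    simp only [Pi.sub_apply, column]
    split_ifs <;> omega
  · intro k hk
    have := hs.right_eq_zero hk
    simp only [Pi.sub_apply, Pi.add_apply, column]
    split_ifs <;> omega
  · intro k
    have := hgap k
    have := hg k
    simp only at *
    omega
  · have := hg r
    simp only at *
    omega
  · simp only
    omega
  · simp only
    omega
  · simpa using antitone_column x
  · simpa using antitone_column y
  · intro k
    have := hg k
    simp only [gap] at *
    omega
  · simp [column]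
    omega

/-- As long as the left side of a valid stage has no column matching the leftover column exactly, a
further pair of columns can be removed. -/
lemma Valid.exists_next {r : ℕ} {s : Stage} (hs : s.Valid r)
    (h : s.left (s.height - 1) ≤ s.left s.height) :
    ∃ t : Stage, t.Valid r ∧ s.Le t ∧ t.left 0 + 1 = s.left 0 := by
  have hz := hs.height_pos
  have hpos : ∀ k, 0 ≤ s.gap k := hs.pair.excess_nonneg
  have hR := hs.antitone_right (Nat.sub_le s.height 1)
  -- Across the leftover height `left` does not drop while `right + column` drops by at least one,
  -- so the integer slope of the gap rises.
  have hkink : 1 ≤ s.left s.height - (s.right + column s.height) s.height ∨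
      s.left (s.height - 1) - (s.right + column s.height) (s.height - 1) ≤ -1 := by
    simp [column, hz]
    omega
  rcases hkink with h1 | h1
  · obtain ⟨x, y, hzx, hxy, hyr, hx, hy, hT⟩ := exists_trapezoid_right s.gap_succ hpos
      (fun k hk => hs.pair.excess_eq_zero_of_le hk) h1
    have h2 := hs.antitone_right (Nat.sub_le x 1)
    have h3 := hs.pair.antitone_left (Nat.sub_le y 1)
    refine hs.exchange hyr (Or.inl ⟨hzx, hxy⟩) ?_ (fun _ => ?_) hT
    -- The leftover column is constant across `x` and `y`, so a falling slope at `x` forces a drop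
    -- of `left`, and a rising slope at `y` a drop of `right`.
    · simp only [Pi.add_apply, column] at hx
      split_ifs at hx <;> omega
    · simp only [Pi.add_apply, column] at hy
      split_ifs at hy <;> omega
  · obtain ⟨x, y, hyx, hxz, hx, hy, hT⟩ := exists_trapezoid_left s.gap_succ hpos
      (excess_zero _ _) hz h1
    have h2 := hs.antitone_right (Nat.sub_le x 1)
    have h3 := hs.pair.antitone_left (Nat.sub_le y 1)
    refine hs.exchange (by have := hs.height_le; omega) (Or.inr ⟨hyx, hxz⟩) ?_ (fun h0 => ?_) hT
    · simp only [Pi.add_apply, column] at hx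
      split_ifs at hx <;> omega
    · have := hy h0
      simp only [Pi.add_apply, column] at this
      split_ifs at this <;> omega

end Stage

/-! ### Splitting a dominant pair -/

lemma excess_sub_sub_eq {s t : Stage} (h : s.height = t.height) (k : ℕ) :
    excess (s.left - t.left) (s.right - t.right) k = s.gap k - t.gap k := by
  rw [Stage.gap, Stage.gap, ← excess_sub, h, add_sub_add_right_eq_sub]

/-- The removed part `s.left - t.left` is antitone and vanishes at `r`. -/
lemma left_zero_le {r : ℕ} {s t : Stage} (hs : s.Valid r) (ht : t.Valid r) (hst : s.Le t) :
    t.left 0 ≤ s.left 0 := by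
  have h := hst.antitone_left (Nat.zero_le r)
  have h1 := hs.pair.left_eq_zero r le_rfl
  have h2 := ht.pair.left_eq_zero r le_rfl
  simp only [Pi.sub_apply] at h
  omega

/-- Two stages with the same leftover height split the initial pair. -/
lemma splits_of_height_eq {r : ℕ} {s t u : Stage} (hs : s.Valid r) (ht : t.Valid r)
    (hu : u.Valid r) (hst : s.Le t) (htu : t.Le u) (hheight : t.height = u.height)
    (hlt : u.left 0 < t.left 0) (hpos : 0 < u.left 0) :
    Splits r s.left (s.right + column s.height) := by
  have hexc := excess_sub_sub_eq hheight
  have hexc' : ∀ k, excess (s.left - (t.left - u.left))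
      (s.right + column s.height - (t.right - u.right)) k = s.gap k - (t.gap k - u.gap k) :=
    fun k => by rw [excess_sub, hexc]; rfl
  have hsr : s.gap r = 0 := hs.pair.excess_eq_zero
  have htr : t.gap r = 0 := ht.pair.excess_eq_zero
  have hur : u.gap r = 0 := hu.pair.excess_eq_zero
  refine ⟨t.left - u.left, t.right - u.right,
    ⟨htu.antitone_left, htu.antitone_right, fun k hk => ?_, fun k hk => ?_, fun k => ?_, ?_⟩,
    ⟨?_, ?_, fun k hk => ?_, fun k hk => ?_, fun k => ?_, ?_⟩, ?_, ?_⟩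
  · simp [ht.pair.left_eq_zero k hk, hu.pair.left_eq_zero k hk]
  · simp [ht.right_eq_zero hk, hu.right_eq_zero hk]
  · rw [hexc]
    linarith [htu.gap_le k]
  · rw [hexc, htr, hur, sub_self]
  · rw [← sub_add]
    exact hst.antitone_left.add hu.pair.antitone_left
  · rw [show s.right + column s.height - (t.right - u.right)
      = s.right - t.right + (u.right + column s.height) by abel]
    exact hst.antitone_right.add (hu.antitone_right.add (antitone_column _))
  · simp [hs.pair.left_eq_zero k hk, ht.pair.left_eq_zero k hk, hu.pair.left_eq_zero k hk]
  · rw [Pi.sub_apply, hs.pair.right_eq_zero k hk]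
    simp [ht.right_eq_zero hk, hu.right_eq_zero hk]
  -- The complement's excess regroups as `(s.gap - t.gap) + u.gap`.
  · have h0 : 0 ≤ u.gap k := hu.pair.excess_nonneg k
    rw [hexc']
    linarith [hst.gap_le k]
  · rw [hexc', hsr, htr, hur]
    simp
  · simpa using hlt
  · have := left_zero_le hs ht hst
    simp only [Pi.sub_apply]
    omega

/-- A column matching the leftover one splits the initial pair. -/
lemma splits_of_left_lt {r : ℕ} {s t : Stage} (hs : s.Valid r) (ht : t.Valid r)
    (hst : s.Le t) (h : t.left t.height < t.left (t.height - 1)) (hone : 1 < t.left 0) :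
    Splits r s.left (s.right + column s.height) := by
  have hz := ht.height_pos
  have hexc : ∀ k, excess (t.left - column t.height) t.right k = t.gap k := fun k => by
    simp only [excess, Stage.gap, Pi.sub_apply, Pi.add_apply]
    exact Finset.sum_congr rfl fun _ _ => by ring
  have hexc' : ∀ k, excess (s.left - (t.left - column t.height))
      (s.right + column s.height - t.right) k = s.gap k - t.gap k :=
    fun k => by rw [excess_sub, hexc]; rfl
  have hsr : s.gap r = 0 := hs.pair.excess_eq_zero
  have htr : t.gap r = 0 := ht.pair.excess_eq_zero
  have hcol : ∀ k, r ≤ k → column t.height k = 0 := fun k hk => by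
    have := ht.height_le
    simp [column]
    omega
  refine ⟨t.left - column t.height, t.right,
    ⟨antitone_sub_column ht.pair.antitone_left fun _ => h, ht.antitone_right, fun k hk => ?_,
      fun k hk => ht.right_eq_zero hk, fun k => ?_, ?_⟩,
    ⟨?_, ?_, fun k hk => ?_, fun k hk => ?_, fun k => ?_, ?_⟩, ?_, ?_⟩
  · simp [ht.pair.left_eq_zero k hk, hcol k hk]
  · rw [hexc]
    exact ht.pair.excess_nonneg k
  · rw [hexc, htr]
  · rw [← sub_add]
    exact hst.antitone_left.add (antitone_column _)
  · rw [add_sub_right_comm]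
    exact hst.antitone_right.add (antitone_column _)
  · simp [hs.pair.left_eq_zero k hk, ht.pair.left_eq_zero k hk, hcol k hk]
  · rw [Pi.sub_apply, hs.pair.right_eq_zero k hk, ht.right_eq_zero hk, sub_self]
  · rw [hexc']
    linarith [hst.gap_le k]
  · rw [hexc', hsr, htr, sub_self]
  · simp [column, hz]
    omega
  · have := left_zero_le hs ht hst
    simp [column, hz]
    omega

/-- If the pair of a valid stage does not split, columns can be removed until only one is left. -/
lemma exists_chain {r : ℕ} {s : Stage} (hs : s.Valid r)
    (hsplit : ¬ Splits r s.left (s.right + column s.height)) (j : ℕ) (hj : (j : ℤ) < s.left 0) :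
    ∃ σ : ℕ → Stage, ∀ i ≤ j, (σ i).Valid r ∧ s.Le (σ i) ∧ (σ i).left 0 + i = s.left 0 ∧
      ∀ i' ≤ i, (σ i').Le (σ i) := by
  induction j with
  | zero =>
    refine ⟨fun _ => s, fun i hi => ?_⟩
    obtain rfl : i = 0 := by omega
    exact ⟨hs, Stage.Le.refl s, by simp, fun _ _ => Stage.Le.refl s⟩
  | succ j ih =>
    push_cast at hj
    obtain ⟨σ, hσ⟩ := ih (by omega)
    obtain ⟨hv, hle, h0, hch⟩ := hσ j le_rfl
    obtain ⟨t, htv, htle, ht0⟩ := hv.exists_next (by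
      by_contra! h
      exact hsplit (splits_of_left_lt hs hv hle h (by omega)))
    refine ⟨fun i => if i ≤ j then σ i else t, fun i hi => ?_⟩
    rcases Nat.lt_or_ge j i with hij | hij
    · simp only [if_neg (show ¬ i ≤ j by omega)]
      refine ⟨htv, hle.trans htle, by omega, fun i' hi' => ?_⟩
      split_ifs with h
      · exact (hch i' h).trans htle
      · exact Stage.Le.refl t
    · simp only [if_pos hij]
      obtain ⟨h1, h2, h3, h4⟩ := hσ i hij
      refine ⟨h1, h2, h3, fun i' hi' => ?_⟩
      rw [if_pos (by omega)]
      exact h4 i' hi'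

/-- A dominant pair with more than `r` columns on the left and a full column on the right splits. -/
theorem splits_of_lt {r : ℕ} {a b : ℕ → ℤ} (h : DominantPair r a b) (hr : 0 < r)
    (hb : 0 < b (r - 1)) (ha : (r : ℤ) < a 0) : Splits r a b := by
  have hbr := h.right_eq_zero r le_rfl
  have hanti : Antitone (b - column r) := antitone_sub_column h.antitone_right fun _ => by omega
  have hb' : b - column r + column r = b := sub_add_cancel _ _
  let s : Stage := ⟨a, b - column r, r⟩
  have hs : s.Valid r := ⟨hanti, by simpa only [s, hb'] using h, hr, le_rfl⟩
  suffices Splits r s.left (s.right + column s.height) by simpa only [s, hb'] using this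
  by_contra hsplit
  obtain ⟨σ, hσ⟩ := exists_chain hs hsplit r ha
  have key : ∀ i j, i < j → j ≤ r → (σ i).height ≠ (σ j).height := fun i j hij hj he => by
    obtain ⟨hiv, hile, hi0, -⟩ := hσ i (by omega)
    obtain ⟨hjv, -, hj0, hjch⟩ := hσ j hj
    exact hsplit (splits_of_height_eq hs hiv hjv hile (hjch i hij.le) he (by omega)
      (by have : s.left 0 = a 0 := rfl
          omega))
  -- Pigeonhole: `r + 1` stages, but only `r` possible leftover heights.
  obtain ⟨i, hi, j, hj, hij, he⟩ := Finset.exists_ne_map_eq_of_card_lt_of_maps_to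
    (s := Finset.range (r + 1)) (t := Finset.Icc 1 r) (f := fun i => (σ i).height) (by simp)
    (fun i hi => by
      have hv := (hσ i (by simpa [Nat.lt_succ_iff] using hi)).1
      simpa using ⟨hv.height_pos, hv.height_le⟩)
  simp only [Finset.mem_range] at hi hj
  rcases lt_or_gt_of_ne hij with hlt | hlt
  · exact key i j hlt (by omega) he
  · exact key j i hlt (by omega) he.symm

/-! ### Hilbert bases and irreducible points -/

/-- The additive irreducibles among the integral points of a cone. -/
def irreduciblePoints {ι : Type*} (C : Set (ι → ℝ)) : Set (ι → ℝ) :=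
  {x | x ∈ integralPoints C ∧ x ≠ 0 ∧
    ∀ y ∈ integralPoints C, ∀ z ∈ integralPoints C, x = y + z → y = 0 ∨ z = 0}

/-- The irreducible points lie in every Hilbert basis. -/
lemma irreduciblePoints_subset {ι : Type*} {C H : Set (ι → ℝ)} (h0 : 0 ∈ integralPoints C)
    (hadd : ∀ x ∈ integralPoints C, ∀ y ∈ integralPoints C, x + y ∈ integralPoints C)
    (hH : IsHilbertBasis C H) : irreduciblePoints C ⊆ H := by
  intro x hx
  have hmem := hH.generates x hx.1
  rw [← Submodule.mem_toAddSubmonoid, Submodule.span_nat_eq_addSubmonoidClosure] at hmem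
  -- Integrality is carried along because irreducibility can only be applied to summands that are
  -- integral points.
  suffices x ∈ integralPoints C ∧ (x ∈ irreduciblePoints C → x ∈ H) from this.2 hx
  clear hx
  induction hmem using AddSubmonoid.closure_induction with
  | mem x hx => exact ⟨hH.subset hx, fun _ => hx⟩
  | zero => exact ⟨h0, fun h => absurd rfl h.2.1⟩
  | add y z _ _ hy hz =>
    refine ⟨hadd y hy.1 z hz.1, fun h => ?_⟩
    rcases h.2.2 y hy.1 z hz.1 rfl with rfl | rfl
    · rw [zero_add] at h ⊢
      exact hz.2 h
    · rw [add_zero] at h ⊢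
      exact hy.2 h

/-- Being contained in every Hilbert basis, the irreducibles form the least one, hence the only
minimal one. -/
lemma isTheHilbertBasis_irreduciblePoints_of_isHilbertBasis {ι : Type*} {C : Set (ι → ℝ)}
    (h0 : 0 ∈ integralPoints C)
    (hadd : ∀ x ∈ integralPoints C, ∀ y ∈ integralPoints C, x + y ∈ integralPoints C)
    (hC : IsHilbertBasis C (irreduciblePoints C)) :
    IsTheHilbertBasis C (irreduciblePoints C) :=
  ⟨⟨hC, fun _ hH' _ => irreduciblePoints_subset h0 hadd hH'⟩, fun _ hH' =>
    (hH'.2 hC (irreduciblePoints_subset h0 hadd hH'.1)).antisymm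
      (irreduciblePoints_subset h0 hadd hH'.1)⟩

/-- A pointed cone cut out by finitely many integral functionals has a Hilbert basis, namely its
irreducible integral points. -/
theorem isTheHilbertBasis_irreduciblePoints {ι κ : Type*} [Fintype κ] {C : Set (ι → ℝ)}
    (φ : κ → (ι → ℝ) →+ ℝ) (hC : ∀ x, x ∈ C ↔ ∀ j, 0 ≤ φ j x)
    (hint : ∀ x : ι → ℝ, (∀ i, ∃ z : ℤ, x i = z) → ∀ j, ∃ z : ℤ, φ j x = z)
    (hinj : ∀ x, (∀ j, φ j x = 0) → x = 0) :
    IsTheHilbertBasis C (irreduciblePoints C) := by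
  have h0 : 0 ∈ integralPoints C := ⟨by simp [hC], fun i => ⟨0, by simp⟩⟩
  have hadd : ∀ x ∈ integralPoints C, ∀ y ∈ integralPoints C, x + y ∈ integralPoints C := by
    rintro x ⟨hx, hx'⟩ y ⟨hy, hy'⟩
    rw [hC] at hx hy
    refine ⟨(hC _).2 fun j => by rw [map_add]; exact add_nonneg (hx j) (hy j), fun i => ?_⟩
    obtain ⟨u, hu⟩ := hx' i
    obtain ⟨v, hv⟩ := hy' i
    exact ⟨u + v, by simp [hu, hv]⟩
  have hnat : ∀ x ∈ integralPoints C, ∀ j, ((⌊φ j x⌋₊ : ℕ) : ℝ) = φ j x := by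
    intro x hx j
    obtain ⟨z, hz⟩ := hint x hx.2 j
    have hz0 : 0 ≤ φ j x := (hC x).1 hx.1 j
    rw [hz] at hz0 ⊢
    lift z to ℕ using by exact_mod_cast hz0
    simp
  refine isTheHilbertBasis_irreduciblePoints_of_isHilbertBasis h0 hadd
    ⟨?_, fun x hx => hx.1, fun x hx => ?_⟩
  · let F : (ι → ℝ) → κ → ℕ := fun x j => ⌊φ j x⌋₊
    have hF : ∀ x ∈ irreduciblePoints C, ∀ y ∈ irreduciblePoints C, F x ≤ F y → x = y := by
      intro x hx y hy hxy
      have hle : ∀ j, φ j x ≤ φ j y := fun j => by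
        rw [← hnat x hx.1 j, ← hnat y hy.1 j]
        exact_mod_cast hxy j
      have hd : y - x ∈ integralPoints C := by
        refine ⟨(hC _).2 fun j => by rw [map_sub]; exact sub_nonneg.2 (hle j), fun i => ?_⟩
        obtain ⟨u, hu⟩ := hx.1.2 i
        obtain ⟨v, hv⟩ := hy.1.2 i
        exact ⟨v - u, by simp [hu, hv]⟩
      rcases hy.2.2 x hx.1 (y - x) hd (by abel) with h | h
      · exact absurd h hx.2.1
      · exact (sub_eq_zero.1 h).symm
    refine Set.Finite.of_finite_image (f := F) ?_ fun x hx y hy hxy => hF x hx y hy hxy.le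
    -- Dickson's lemma: the functional values of irreducibles form an antichain in `κ → ℕ`.
    refine WellQuasiOrderedLE.finite_of_isAntichain ?_
    rintro _ ⟨x, hx, rfl⟩ _ ⟨y, hy, rfl⟩ hne hle
    exact hne (congrArg F (hF x hx y hy hle))
  -- The sum of the functional values is additive and positive off `0`, so decomposing terminates.
  · obtain ⟨N, hN⟩ : ∃ N : ℕ, ∑ j, ⌊φ j x⌋₊ = N := ⟨_, rfl⟩
    induction N using Nat.strong_induction_on generalizing x with
    | _ N ih =>
      by_cases hx0 : x = 0
      · rw [hx0]
        exact zero_mem _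
      by_cases hirr : x ∈ irreduciblePoints C
      · exact Submodule.subset_span hirr
      have hpos : ∀ y ∈ integralPoints C, y ≠ 0 → 0 < ∑ j, ⌊φ j y⌋₊ := by
        intro y hy hy0
        by_contra! h
        refine hy0 (hinj y fun j => ?_)
        have h1 : ∑ j, ⌊φ j y⌋₊ = 0 := by omega
        rw [← hnat y hy j, Finset.sum_eq_zero_iff.1 h1 j (Finset.mem_univ j)]
        simp
      simp only [irreduciblePoints, Set.mem_ofPred_eq, not_and, not_forall, not_or] at hirr
      obtain ⟨y, hy, z, hz, rfl, hy0, hz0⟩ := hirr hx hx0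
      have hsum : ∑ j, ⌊φ j (y + z)⌋₊ = ∑ j, ⌊φ j y⌋₊ + ∑ j, ⌊φ j z⌋₊ := by
        rw [← Finset.sum_add_distrib]
        refine Finset.sum_congr rfl fun j _ => ?_
        have := hnat _ hx j
        rw [map_add, ← hnat y hy j, ← hnat z hz j] at this
        rw [map_add, ← hnat y hy j, ← hnat z hz j]
        simp only [Nat.floor_natCast]
        exact_mod_cast this
      have h1 := hpos y hy hy0
      have h2 := hpos z hz hz0
      exact add_mem (ih _ (by omega) y hy rfl) (ih _ (by omega) z hz rfl)

/-! ### The Kostka cone -/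

/-- The functionals cutting out the Kostka cone: differences of entries, entries, partial sums of
differences, and both signs of the total difference. -/
noncomputable def kostkaFunctional (r : ℕ) :
    ({p : Fin r × Fin r // p.1 ≤ p.2} ⊕ Fin r) ⊕ ({p : Fin r × Fin r // p.1 ≤ p.2} ⊕ Fin r) ⊕
      Fin r ⊕ Unit ⊕ Unit → (Fin r ⊕ Fin r → ℝ) →+ ℝ :=
  let a (i : Fin r) := Pi.evalAddMonoidHom (fun _ : Fin r ⊕ Fin r => ℝ) (Sum.inl i)
  let b (i : Fin r) := Pi.evalAddMonoidHom (fun _ : Fin r ⊕ Fin r => ℝ) (Sum.inr i)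
  Sum.elim (Sum.elim (fun p => a p.1.1 - a p.1.2) a) <|
    Sum.elim (Sum.elim (fun p => b p.1.1 - b p.1.2) b) <|
      Sum.elim (fun t => ∑ i ∈ Finset.Iic t, (a i - b i)) <|
        Sum.elim (fun _ => ∑ i, (b i - a i)) fun _ => ∑ i, (a i - b i)

lemma mem_kostkaCone_iff (r : ℕ) (x : Fin r ⊕ Fin r → ℝ) :
    x ∈ kostkaCone r ↔ ∀ j, 0 ≤ kostkaFunctional r j x := by
  have h : x ∈ kostkaCone r ↔ Antitone (fun i => x (Sum.inl i)) ∧ (∀ i, 0 ≤ x (Sum.inl i)) ∧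
    Antitone (fun i => x (Sum.inr i)) ∧ (∀ i, 0 ≤ x (Sum.inr i)) ∧
    (∀ t : Fin r, ∑ i ∈ Finset.Iic t, x (Sum.inr i) ≤ ∑ i ∈ Finset.Iic t, x (Sum.inl i)) ∧
    ∑ i, x (Sum.inl i) = ∑ i, x (Sum.inr i) := by
    constructor
    · rintro ⟨a, b, rfl, h⟩
      exact h
    · intro h
      exact ⟨_, _, (Sum.elim_comp_inl_inr x).symm, h⟩
  rw [h]
  simp only [kostkaFunctional, Sum.forall, Sum.elim_inl, Sum.elim_inr, forall_const,
    AddMonoidHom.sub_apply, AddMonoidHom.finsetSum_apply,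
    Pi.evalAddMonoidHom_apply, Subtype.forall, Prod.forall, Finset.sum_sub_distrib, sub_nonneg,
    Antitone, le_antisymm_iff (α := ℝ), and_assoc]

lemma isTheHilbertBasis_kostkaCone (r : ℕ) :
    IsTheHilbertBasis (kostkaCone r) (irreduciblePoints (kostkaCone r)) := by
  refine isTheHilbertBasis_irreduciblePoints (kostkaFunctional r) (mem_kostkaCone_iff r)
    (fun x hx j => ?_) fun x hx => ?_
  · have hsub : ∀ u v : Fin r ⊕ Fin r, x u - x v ∈ (Int.castAddHom ℝ).range := fun u v => by
      obtain ⟨p, hp⟩ := hx u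
      obtain ⟨q, hq⟩ := hx v
      exact ⟨p - q, by simp [hp, hq]⟩
    suffices kostkaFunctional r j x ∈ (Int.castAddHom ℝ).range by
      obtain ⟨z, hz⟩ := this
      exact ⟨z, hz.symm⟩
    have hx' : ∀ u, x u ∈ (Int.castAddHom ℝ).range := fun u => by
      obtain ⟨p, hp⟩ := hx u
      exact ⟨p, hp.symm⟩
    rcases j with (j | j) | (j | j) | j | (j | j) <;>
      simp only [kostkaFunctional, Sum.elim_inl, Sum.elim_inr, AddMonoidHom.sub_apply,
        Pi.evalAddMonoidHom_apply, AddMonoidHom.finsetSum_apply, hsub, hx'] <;>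
      exact sum_mem fun i _ => hsub _ _
  · ext (i | i)
    · exact hx (Sum.inl (Sum.inr i))
    · exact hx (Sum.inr (Sum.inl (Sum.inr i)))

/-- The point of `ℝ ^ (2 r)` given by the first `r` entries of two integer sequences. -/
def sequencePoint (r : ℕ) (a b : ℕ → ℤ) : Fin r ⊕ Fin r → ℝ :=
  Sum.elim (fun i => (a i : ℝ)) (fun i => (b i : ℝ))

lemma DominantPair.sequencePoint_mem {s r : ℕ} {a b : ℕ → ℤ} (h : DominantPair s a b)
    (hr : s ≤ r) : sequencePoint r a b ∈ integralPoints (kostkaCone r) := by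
  have hIic : ∀ (c : ℕ → ℤ) (t : Fin r),
      ∑ i ∈ Finset.Iic t, (c i : ℝ) = ((∑ i ∈ Finset.range (t + 1), c i : ℤ) : ℝ) := by
    intro c t
    push_cast
    rw [← Nat.Iio_eq_range, show Finset.Iio ((t : ℕ) + 1) = Finset.Iic (t : ℕ) by ext; simp,
      ← Fin.map_valEmbedding_Iic, Finset.sum_map]
    rfl
  refine ⟨⟨_, _, rfl, fun i j hij => ?_, fun i => ?_, fun i j hij => ?_, fun i => ?_, fun t => ?_,
    ?_⟩, ?_⟩
  · exact Int.cast_le.2 (h.antitone_left hij)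
  · exact_mod_cast h.left_nonneg i
  · exact Int.cast_le.2 (h.antitone_right hij)
  · exact_mod_cast h.right_nonneg i
  · rw [hIic, hIic]
    have := h.excess_nonneg (t + 1)
    rw [excess, Finset.sum_sub_distrib] at this
    exact_mod_cast sub_nonneg.1 this
  · have := h.excess_eq_zero_of_le hr
    rw [excess, Finset.sum_sub_distrib, sub_eq_zero] at this
    rw [Fin.sum_univ_eq_sum_range (fun i => (a i : ℝ)),
      Fin.sum_univ_eq_sum_range (fun i => (b i : ℝ))]
    exact_mod_cast this
  · rintro (i | i)
    · exact ⟨a i, rfl⟩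
    · exact ⟨b i, rfl⟩

lemma Splits.sequencePoint_notMem {s r : ℕ} {a b : ℕ → ℤ} (h : Splits s a b) (hs : 0 < s)
    (hr : s ≤ r) : sequencePoint r a b ∉ irreduciblePoints (kostkaCone r) := by
  obtain ⟨a', b', h1, h2, h3, h4⟩ := h
  intro hirr
  have hne : ∀ c d : ℕ → ℤ, 0 < c 0 → sequencePoint r c d ≠ 0 := by
    intro c d hc h0
    have : (c 0 : ℝ) = 0 := congrFun h0 (Sum.inl ⟨0, by omega⟩)
    norm_cast at this
    omega
  rcases hirr.2.2 _ (h1.sequencePoint_mem hr) _ (h2.sequencePoint_mem hr)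
    (by ext (i | i) <;> simp [sequencePoint]) with h | h
  · exact hne _ _ h3 h
  · exact hne _ _ h4 h

/-! ### From partitions to dominant pairs -/

section Partition

variable {n : ℕ} (p : n.Partition)

lemma antitone_part : Antitone (part p) := by
  intro i j hij
  have hsort := Multiset.pairwise_sort p.parts (· ≥ ·)
  unfold part
  rcases Nat.lt_or_ge j (p.parts.sort (· ≥ ·)).length with hj | hj
  · rw [List.getD_eq_getElem _ _ hj, List.getD_eq_getElem _ _ (hij.trans_lt hj)]
    exact hsort.rel_get_of_le (a := ⟨i, hij.trans_lt hj⟩) (b := ⟨j, hj⟩) hij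
  · rw [List.getD_eq_default _ _ hj]
    exact Nat.zero_le _

lemma part_eq_zero {i : ℕ} (hi : length p ≤ i) : part p i = 0 :=
  List.getD_eq_default _ _ (by simpa [length] using hi)

lemma part_pos {i : ℕ} (hi : i < length p) : 0 < part p i := by
  have hi' : i < (p.parts.sort (· ≥ ·)).length := by simpa [length] using hi
  rw [part, List.getD_eq_getElem _ _ hi']
  exact p.parts_pos ((Multiset.mem_sort _).1 (List.getElem_mem hi'))

lemma sum_part {k : ℕ} (hk : length p ≤ k) : ∑ i ∈ Finset.range k, part p i = n := by
  have hlen : (p.parts.sort (· ≥ ·)).length = length p := by simp [length]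
  have h : ∑ i ∈ Finset.range (length p), part p i = n := by
    rw [← hlen, ← Fin.sum_univ_eq_sum_range]
    simp only [part, List.getD_eq_getElem, Fin.is_lt]
    rw [Fin.sum_univ_getElem, ← Multiset.sum_coe, Multiset.sort_eq, p.parts_sum]
  refine (Finset.sum_subset (by simpa using hk) fun i _ hi => part_eq_zero p ?_).symm.trans h
  simpa using hi

variable {p}

/-- The first `length q` parts of `q` already sum to `n`, so by dominance those of `p` do too,
leaving nothing for later parts. -/
lemma Dominates.part_eq_zero {q : n.Partition} (h : Dominates p q) {i : ℕ} (hi : length q ≤ i) :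
    part p i = 0 := by
  have h1 := h (length q)
  rw [sum_part q le_rfl] at h1
  have h2 := sum_part p (k := max (length p) (i + 1)) (le_max_left _ _)
  have h3 : ∑ j ∈ Finset.range (i + 1), part p j ≤ n :=
    (Finset.sum_le_sum_of_subset (by simp)).trans h2.le
  have h4 : ∑ j ∈ Finset.range (length q), part p j ≤ ∑ j ∈ Finset.range i, part p j :=
    Finset.sum_le_sum_of_subset (by simpa using hi)
  rw [Finset.sum_range_succ] at h3
  omega

lemma Dominates.dominantPair {q : n.Partition} (h : Dominates p q) :
    DominantPair (length q) (fun i => (part p i : ℤ)) (fun i => (part q i : ℤ)) where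
  antitone_left _ _ hij := Int.ofNat_le.2 (antitone_part p hij)
  antitone_right _ _ hij := Int.ofNat_le.2 (antitone_part q hij)
  left_eq_zero k hk := by exact_mod_cast h.part_eq_zero hk
  right_eq_zero k hk := by exact_mod_cast KostkaSemigroup.part_eq_zero q hk
  excess_nonneg k := by
    rw [excess, Finset.sum_sub_distrib, sub_nonneg]
    exact_mod_cast h k
  excess_eq_zero := by
    have h1 := sum_part p (le_max_left (length p) (length q))
    rw [← Finset.sum_subset (s₁ := Finset.range (length q)) (by simp)
      fun i _ hi => h.part_eq_zero (by simpa using hi)] at h1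
    rw [excess, Finset.sum_sub_distrib, sub_eq_zero]
    exact_mod_cast h1.trans (sum_part q le_rfl).symm

end Partition

end KostkaSemigroup

theorem corollary1p4 {n : ℕ} (lam mu : n.Partition)
    (hdom : KostkaSemigroup.Dominates lam mu)
    (hlen : KostkaSemigroup.length mu < KostkaSemigroup.part lam 0)
    (r : ℕ) (hr : KostkaSemigroup.length mu ≤ r) :
    ∃ H : Set (Fin r ⊕ Fin r → ℝ),
      KostkaSemigroup.IsTheHilbertBasis (KostkaSemigroup.kostkaCone r) H ∧
        KostkaSemigroup.pairVector r lam mu ∉ H := by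
  have hpos : 0 < KostkaSemigroup.length mu := by
    by_contra h
    have := hdom.part_eq_zero (i := 0) (by omega)
    omega
  refine ⟨_, KostkaSemigroup.isTheHilbertBasis_kostkaCone r, ?_⟩
  have hsplit := KostkaSemigroup.splits_of_lt hdom.dominantPair hpos
    (by exact_mod_cast KostkaSemigroup.part_pos mu (by omega)) (by exact_mod_cast hlen)
  have h := hsplit.sequencePoint_notMem hpos hr
  simpa only [KostkaSemigroup.sequencePoint, KostkaSemigroup.pairVector, Int.cast_natCast] using h
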